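/- Let $\Gamma$ be a torsionless grading monoid (a commutative, cancellative, torsion-free monoid, written additively), let $\langle\Gamma\rangle$ be its group of differences, and let $R=\bigoplus_{\alpha\in\Gamma}R_\alpha$ be a $\Gamma$-graded integral domain with fraction field $K$. Let $H$ be the set of nonzero homogeneous elements of $R$, and let $R_H\subseteq K$ be the graded quotient field, with components $(R_H)_\alpha=\{0\}\cup\{f/g : f,g\in H,\ \deg f-\deg g=\alpha\}$ for $\alpha\in\langle\Gamma\rangle$. A graded overring of $R$ is a ring $T$ with $R\subseteq T\subseteq R_H$ and $T=\bigoplus_{\alpha\in\langle\Gamma\rangle}\bigl(T\cap(R_H)_\alpha\bigr)$. For a graded overring $T$ of $R$, the extension $R\subseteq T$ is a gr-$i$-extension (graded $i$-extension) if any two homogeneous prime ideals $Q_1,Q_2$ of $T$ with $Q_1\cap R=Q_2\cap R$ are equal. The domain $R$ is a gr-$i$-domain if $R\subseteq T$ is a gr-$i$-extension for every graded overring $T$ of $R$. A graded integral domain is gr-Prüfer if each of its nonzero finitely generated homogeneous ideals is invertible. Let $R'$ be the integral closure of $R$ in $K$. Then $R'$ is a graded overring of $R$, and $R$ is a gr-$i$-domain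 if and only if $R\subseteq R'$ is a gr-$i$-extension and $R'$ is a gr-Prüfer domain. -/

import Mathlib

open scoped nonZeroDivisors

noncomputable section

/-- The group `⟨Γ⟩` of differences of `Γ` is `Algebra.GrothendieckAddGroup Γ`; gradings indexed by it
use classical decidability of equality. -/
instance differenceGroupDecidableEq (Γ : Type*) [AddCommMonoid Γ] :
    DecidableEq (Algebra.GrothendieckAddGroup Γ) :=
  Classical.decEq _

section GradedQuotientField

variable {Γ R : Type*} [AddCommMonoid Γ] [IsCancelAdd Γ] [DecidableEq Γ]
  [CommRing R] [IsDomain R]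
  (𝒜 : Γ → AddSubgroup R) [GradedRing 𝒜]
  (K : Type*) [Field K] [Algebra R K] [IsFractionRing R K]

/-- The graded quotient field `R_H` inside the fraction field `K` of `R`, where `H` is the
multiplicative set of nonzero homogeneous elements of `R`. -/
def gradedQuotientField : Subalgebra R K :=
  Localization.subalgebra.ofField K (SetLike.homogeneousSubmonoid 𝒜 ⊓ R⁰) inf_le_right

/-- The component `(R_H)_α`, for `α ∈ ⟨Γ⟩`: all `f / g` with `f`, `g` homogeneous, `g ≠ 0` and
`deg f - deg g = α`, together with `0`. -/
def gradedQuotientComponent (α : Algebra.GrothendieckAddGroup Γ) : AddSubgroup K where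
  carrier := {x | x = 0 ∨ ∃ (β γ : Γ) (f g : R), f ∈ 𝒜 β ∧ g ∈ 𝒜 γ ∧ g ≠ 0 ∧
    Algebra.GrothendieckAddGroup.of β - Algebra.GrothendieckAddGroup.of γ = α ∧
    x = algebraMap R K f / algebraMap R K g}
  zero_mem' := Or.inl rfl
  add_mem' := by
    rintro x y (rfl | ⟨β, γ, f, g, hf, hg, h0, hα, rfl⟩) hy
    · rwa [zero_add]
    rcases hy with (rfl | ⟨β', γ', f', g', hf', hg', h0', hα', rfl⟩)
    · rw [add_zero]
      exact Or.inr ⟨β, γ, f, g, hf, hg, h0, hα, rfl⟩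
    have hdeg : β' + γ = β + γ' := by
      have h : Algebra.GrothendieckAddGroup.of (β' + γ) =
          Algebra.GrothendieckAddGroup.of (β + γ') := by
        rw [map_add, map_add, ← sub_eq_sub_iff_add_eq_add, hα, hα']
      exact Algebra.GrothendieckAddGroup.of_injective h
    have hK : algebraMap R K g ≠ 0 := by
      simpa using h0
    have hK' : algebraMap R K g' ≠ 0 := by
      simpa using h0'
    refine Or.inr ⟨β + γ', γ + γ', f * g' + f' * g, g * g',
      add_mem (SetLike.mul_mem_graded hf hg') (hdeg ▸ SetLike.mul_mem_graded hf' hg),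
      SetLike.mul_mem_graded hg hg', mul_ne_zero h0 h0', ?_, ?_⟩
    · rw [map_add, map_add, add_sub_add_right_eq_sub, hα]
    · rw [map_add, map_mul, map_mul, map_mul]
      field_simp
  neg_mem' := by
    rintro x (rfl | ⟨β, γ, f, g, hf, hg, h0, hα, rfl⟩)
    · exact Or.inl neg_zero
    exact Or.inr ⟨β, γ, -f, g, neg_mem hf, hg, h0, hα, by rw [map_neg, neg_div]⟩

/-- The family `T ∩ (R_H)_α`, as additive subgroups of an overring `T` of `R`. -/
def overringGrading (T : Subalgebra R K) (α : Algebra.GrothendieckAddGroup Γ) : AddSubgroup T :=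
  (gradedQuotientComponent 𝒜 K α).comap (T.val : T →+ K)

/-- `T` is a graded overring of `R`: `R ⊆ T ⊆ R_H` and `T` is the direct sum of the
`T ∩ (R_H)_α`, `α ∈ ⟨Γ⟩`. -/
def IsGradedOverring (T : Subalgebra R K) : Prop :=
  T ≤ gradedQuotientField 𝒜 K ∧ Nonempty (GradedRing (overringGrading 𝒜 K T))

end GradedQuotientField

/-- The extension `R ⊆ T`, with `T` graded by `ℬ`, is a graded `i`-extension: homogeneous prime
ideals of `T` with the same contraction to `R` are equal. -/
def IsGradedIExtension (R : Type*) {Δ T : Type*} [CommRing R] [CommRing T] [Algebra R T]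
    [AddCommMonoid Δ] [DecidableEq Δ] (ℬ : Δ → AddSubgroup T) [GradedRing ℬ] : Prop :=
  ∀ Q₁ Q₂ : Ideal T, Q₁.IsPrime → Q₂.IsPrime → Q₁.IsHomogeneous ℬ → Q₂.IsHomogeneous ℬ →
    Q₁.comap (algebraMap R T) = Q₂.comap (algebraMap R T) → Q₁ = Q₂

/-- The graded domain `A` is gr-Prüfer: every nonzero finitely generated homogeneous ideal of `A`
is invertible (as a fractional ideal). -/
def IsGradedPrufer {Δ A : Type*} [CommRing A] [IsDomain A]
    [AddCommMonoid Δ] [DecidableEq Δ] (ℬ : Δ → AddSubgroup A) [GradedRing ℬ] : Prop :=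
  ∀ I : Ideal A, I ≠ ⊥ → I.FG → I.IsHomogeneous ℬ →
    IsUnit (I : FractionalIdeal A⁰ (FractionRing A))

/-- The graded domain `R`, with fraction field `K`, is a gr-`i`-domain: `R ⊆ T` is a graded
`i`-extension for every graded overring `T` of `R`. -/
def IsGradedIDomain {Γ R : Type*} [AddCommMonoid Γ] [IsCancelAdd Γ] [DecidableEq Γ]
  [CommRing R] [IsDomain R]
    (𝒜 : Γ → AddSubgroup R) [GradedRing 𝒜]
    (K : Type*) [Field K] [Algebra R K] [IsFractionRing R K] : Prop :=
  ∀ T : Subalgebra R K, IsGradedOverring 𝒜 K T →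
    ∀ [GradedRing (overringGrading 𝒜 K T)], IsGradedIExtension R (overringGrading 𝒜 K T)

end

/-! Write D for the integral closure of R in K, and G for ⟨Γ⟩.

That D is graded is read off from the coaction r ↦ r t^γ (r homogeneous of degree γ), extended to K
with values in fractions of a group algebra over G: x lies in (R_H)_α exactly when it is sent to x
t^α (`mem_gradedQuotientComponent_iff`). If x is integral over R, its image is integral over D[G],
which is integrally closed because G is torsion-free. So the image lies in D[G], and its
coefficients are the homogeneous components of x.

Suppose R is a gr-i-domain, P is a homogeneous prime of D and x ∈ K is homogeneous. If every
polynomial over D vanishing at x had all its coefficients in P, then P D[x] and (P, x) D[x] would be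
distinct homogeneous primes of D[x] with the same contraction to R
(`IsGradedIDomain.exists_coeff_notMem`). So some polynomial has a coefficient outside P, and
lowering its degree puts x or x⁻¹ in D_P (`mem_or_inv_mem_of_coeff_notMem`). Such comparability at
all homogeneous primes makes finitely generated homogeneous ideals invertible
(`isGradedPrufer_of_comparable`).

Conversely, homogeneous primes of T lift to homogeneous primes of the compositum T·D, which is
integral over T. If the primes of T agree on R, their lifts agree on D by the i-extension
hypothesis. Over a gr-Prüfer D a homogeneous prime of T·D is determined by its contraction
(`IsGradedPrufer.le_of_comap_le`), so the lifts coincide. -/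

/-! ### Orders on torsion-free groups -/

/-- A torsion-free abelian group admits a compatible linear order. -/
theorem exists_linearOrder_isOrderedCancelAddMonoid (G : Type*) [AddCommGroup G]
    [IsAddTorsionFree G] : ∃ _ : LinearOrder G, IsOrderedCancelAddMonoid G := by
  classical
  -- G embeds in its divisible hull, a ℚ-vector space, whose coordinates are ordered
  -- lexicographically along a well-ordered basis.
  let b := Module.Basis.ofVectorSpace ℚ (DivisibleHull G)
  let _ : LinearOrder (Module.Basis.ofVectorSpaceIndex ℚ (DivisibleHull G)) :=
    IsWellOrder.linearOrder WellOrderingRel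
  let f : G →+ Lex (Module.Basis.ofVectorSpaceIndex ℚ (DivisibleHull G) →₀ ℚ) :=
    (b.repr.toLinearMap.toAddMonoidHom).comp (DivisibleHull.coeAddMonoidHom G)
  have hf : Function.Injective f := b.repr.injective.comp DivisibleHull.coe_injective
  let l : LinearOrder G := LinearOrder.lift' f hf
  refine ⟨l, Function.Injective.isOrderedCancelAddMonoid f (fun x y => map_add f x y) ?_⟩
  exact Iff.rfl

theorem uniqueSums_of_isAddTorsionFree (G : Type*) [AddCommGroup G] [IsAddTorsionFree G] :
    UniqueSums G := by
  obtain ⟨_, _⟩ := exists_linearOrder_isOrderedCancelAddMonoid G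
  infer_instance

instance grothendieckAddGroup_isAddTorsionFree (Γ : Type*) [AddCommMonoid Γ] [IsCancelAdd Γ]
    [IsAddTorsionFree Γ] : IsAddTorsionFree (Algebra.GrothendieckAddGroup Γ) := by
  have key : ∀ (n : ℕ), n ≠ 0 → ∀ x : Algebra.GrothendieckAddGroup Γ, n • x = 0 → x = 0 := by
    intro n hn x hx
    obtain ⟨⟨a, b⟩, hab⟩ := (AddLocalization.addMonoidOf (⊤ : AddSubmonoid Γ)).surj x
    have hab : x + Algebra.GrothendieckAddGroup.of (b : Γ) =
      Algebra.GrothendieckAddGroup.of a := hab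
    have h : Algebra.GrothendieckAddGroup.of (n • (b : Γ)) =
        Algebra.GrothendieckAddGroup.of (n • a) := by
      rw [map_nsmul, map_nsmul, ← hab, nsmul_add, hx, zero_add]
    have h' := Algebra.GrothendieckAddGroup.of_injective h
    have h2 := IsAddTorsionFree.nsmul_right_injective hn h'
    rw [h2] at hab
    simpa using hab
  refine ⟨fun n hn x y hxy => ?_⟩
  rw [← sub_eq_zero]
  refine key n hn _ ?_
  rw [nsmul_sub]
  exact sub_eq_zero.mpr hxy

/-- For gradings by an ordered group primality of the core is a leading-term argument;
torsion-freeness supplies the order. The decidable equality of the order has to be identified with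
the given one. -/
theorem isPrime_homogeneousCore {Δ A : Type*} [AddCommGroup Δ] [IsAddTorsionFree Δ]
    [inst : DecidableEq Δ] [CommRing A] (ℬ : Δ → AddSubgroup A) [GradedRing ℬ] {I : Ideal A}
    (hI : I.IsPrime) : (I.homogeneousCore ℬ).toIdeal.IsPrime := by
  obtain ⟨l, h⟩ := exists_linearOrder_isOrderedCancelAddMonoid Δ
  have e : inst = l.toDecidableEq := Subsingleton.elim _ _
  subst e
  exact hI.homogeneousCore

/-! ### Group algebras over integrally closed domains -/

section GroupAlgebra

theorem isIntegrallyClosed_laurentPolynomial (A : Type*) [CommRing A] [IsDomain A]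
    [IsIntegrallyClosed A] : IsIntegrallyClosed (LaurentPolynomial A) :=
  isIntegrallyClosed_of_isLocalization (R := Polynomial A) _
    (Submonoid.powers (Polynomial.X : Polynomial A))
    (powers_le_nonZeroDivisors_of_noZeroDivisors Polynomial.X_ne_zero)

/-- Splitting off one factor ℤ turns the algebra into Laurent polynomials over the previous one. -/
theorem isIntegrallyClosed_addMonoidAlgebra_pi (A : Type*) [CommRing A] [IsDomain A]
    [IsIntegrallyClosed A] (n : ℕ) : IsIntegrallyClosed (AddMonoidAlgebra A (Fin n → ℤ)) := by
  induction n with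
  | zero => exact IsIntegrallyClosed.of_equiv (AddMonoidAlgebra.uniqueRingEquiv (R := A)
      (M := Fin 0 → ℤ)).symm
  | succ n ih =>
    have := uniqueSums_of_isAddTorsionFree (Fin n → ℤ)
    let e : ℤ × (Fin n → ℤ) ≃+ (Fin (n + 1) → ℤ) :=
      { Fin.consEquiv (fun _ => ℤ) with
        map_add' := fun x y => by
          ext i
          refine Fin.cases ?_ (fun i => ?_) i <;> simp [Fin.consEquiv] }
    have := isIntegrallyClosed_laurentPolynomial (AddMonoidAlgebra A (Fin n → ℤ))
    have h2 : IsIntegrallyClosed (AddMonoidAlgebra A (ℤ × (Fin n → ℤ))) :=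
      IsIntegrallyClosed.of_equiv (AddMonoidAlgebra.curryRingEquiv (R := A) (M := ℤ)
        (N := Fin n → ℤ)).symm
    exact IsIntegrallyClosed.of_equiv (AddMonoidAlgebra.domCongr A A e).toRingEquiv

theorem isIntegrallyClosed_addMonoidAlgebra_of_fg (A G : Type*) [CommRing A] [IsDomain A]
    [IsIntegrallyClosed A] [AddCommGroup G] [IsAddTorsionFree G] [Module.Finite ℤ G] :
    IsIntegrallyClosed (AddMonoidAlgebra A G) := by
  let b := Module.finBasis ℤ G
  have := isIntegrallyClosed_addMonoidAlgebra_pi A (Module.finrank ℤ G)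
  exact IsIntegrallyClosed.of_equiv
    (AddMonoidAlgebra.domCongr A A b.equivFun.symm.toAddEquiv).toRingEquiv

theorem AddMonoidAlgebra.mem_range_mapDomainRingHom_subtype {A G : Type*} [CommRing A]
    [AddCommGroup G] (H : AddSubgroup G) {f : AddMonoidAlgebra A G}
    (hf : (f.coeff.support : Set G) ⊆ H) :
    f ∈ (AddMonoidAlgebra.mapDomainRingHom A H.subtype).range := by
  rw [← f.sum_coeff_single]
  refine Subring.sum_mem _ fun g hg => ?_
  exact ⟨AddMonoidAlgebra.single ⟨g, hf hg⟩ (f.coeff g), by simp⟩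

/-- A fraction and an integral equation for it involve finitely many exponents, so both descend to
the algebra of a finitely generated subgroup H, which is free. -/
theorem isIntegrallyClosed_addMonoidAlgebra (A G : Type*) [CommRing A] [IsDomain A]
    [IsIntegrallyClosed A] [AddCommGroup G] [IsAddTorsionFree G] :
    IsIntegrallyClosed (AddMonoidAlgebra A G) := by
  classical
  have := uniqueSums_of_isAddTorsionFree G
  rw [isIntegrallyClosed_iff (FractionRing (AddMonoidAlgebra A G))]
  rintro x ⟨p, hp, hx⟩
  obtain ⟨f, g, hg, rfl⟩ := IsFractionRing.div_surjective (A := AddMonoidAlgebra A G) x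
  let S : Finset G := f.coeff.support ∪ g.coeff.support ∪
    p.support.biUnion fun i => (p.coeff i).coeff.support
  let H := AddSubgroup.closure (S : Set G)
  have hS : (S : Set G) ⊆ H := AddSubgroup.subset_closure
  let ι := AddMonoidAlgebra.mapDomainRingHom A H.subtype
  have hι : Function.Injective ι :=
    AddMonoidAlgebra.mapDomain_injective H.subtype_injective
  have := uniqueSums_of_isAddTorsionFree H
  have : AddGroup.FG H := (AddGroup.fg_iff_addSubgroup_fg H).2 ⟨S, rfl⟩
  have : Module.Finite ℤ H := Module.Finite.iff_addGroup_fg.2 this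
  have := isIntegrallyClosed_addMonoidAlgebra_of_fg A H
  obtain ⟨f', hf'⟩ : f ∈ ι.range := AddMonoidAlgebra.mem_range_mapDomainRingHom_subtype H
    (subset_trans (fun _ h => by simp only [S, Finset.coe_union]; exact .inl (.inl h)) hS)
  obtain ⟨g', hg'⟩ : g ∈ ι.range := AddMonoidAlgebra.mem_range_mapDomainRingHom_subtype H
    (subset_trans (fun _ h => by simp only [S, Finset.coe_union]; exact .inl (.inr h)) hS)
  have hl : p ∈ Polynomial.lifts ι := by
    rw [Polynomial.lifts_iff_coeff_lifts]
    intro i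
    by_cases hi : i ∈ p.support
    · exact AddMonoidAlgebra.mem_range_mapDomainRingHom_subtype H (subset_trans
        (fun a h => Finset.mem_union_right _ (Finset.mem_biUnion.2 ⟨i, hi, h⟩)) hS)
    · rw [Polynomial.notMem_support_iff.1 hi]
      exact ⟨0, map_zero ι⟩
  obtain ⟨q, hq, -, hqm⟩ := Polynomial.lifts_and_natDegree_eq_and_monic hl hp
  let F' := FractionRing (AddMonoidAlgebra A H)
  let F := FractionRing (AddMonoidAlgebra A G)
  let j : F' →+* F := IsFractionRing.map hι
  have hj : ∀ a, j (algebraMap _ F' a) = algebraMap _ F (ι a) := fun a => by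
    simp [j, IsFractionRing.map]
  have hjx : j (algebraMap _ F' f' / algebraMap _ F' g') = algebraMap _ F f / algebraMap _ F g := by
    rw [map_div₀, hj, hj, hf', hg']
  have hint : IsIntegral (AddMonoidAlgebra A H) (algebraMap _ F' f' / algebraMap _ F' g') := by
    refine ⟨q, hqm, j.injective ?_⟩
    rw [Polynomial.hom_eval₂, hjx, map_zero, ← hx, ← hq, Polynomial.eval₂_map]
    congr 1
    exact RingHom.ext hj
  obtain ⟨z, hz⟩ := IsIntegrallyClosed.isIntegral_iff.1 hint
  exact ⟨ι z, by rw [← hj, hz, hjx]⟩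

end GroupAlgebra

/-! ### The coaction and gradings of overrings -/

section Coaction

open Algebra (GrothendieckAddGroup)

variable {Γ R : Type*} [AddCommMonoid Γ] [DecidableEq Γ] [CommRing R]
  (𝒜 : Γ → AddSubgroup R) [GradedRing 𝒜]

/-- The coaction `R → C[⟨Γ⟩]` sending a homogeneous element `r` of degree `γ` to `r t ^ γ`. -/
noncomputable def gradingCoaction (C : Type*) [CommRing C] [Algebra R C] :
    R →+* AddMonoidAlgebra C (GrothendieckAddGroup Γ) :=
  (DirectSum.toSemiring (fun γ => (AddMonoidAlgebra.singleAddHom (GrothendieckAddGroup.of γ)).comp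
      ((algebraMap R C).toAddMonoidHom.comp (𝒜 γ).subtype))
    (by simp [GradedMonoid.GOne.one, AddMonoidAlgebra.one_def])
    (fun {i j} a b => by
      simp [GradedMonoid.GMul.mul, AddMonoidAlgebra.single_mul_single])).comp
    (DirectSum.decomposeRingEquiv 𝒜).toRingHom

section

variable (C : Type*) [CommRing C] [Algebra R C]

theorem gradingCoaction_of_mem {γ : Γ} {r : R} (hr : r ∈ 𝒜 γ) :
    gradingCoaction 𝒜 C r =
      AddMonoidAlgebra.single (GrothendieckAddGroup.of γ) (algebraMap R C r) := by
  have : DirectSum.decomposeRingEquiv 𝒜 r = DirectSum.of (fun i => 𝒜 i) γ ⟨r, hr⟩ :=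
    DirectSum.decompose_of_mem 𝒜 hr
  simp [gradingCoaction, this]

/-- Setting t = 1 undoes the coaction; this gives injectivity, and later recovers an element as the
sum of its components. -/
theorem lift_one_gradingCoaction (r : R) :
    AddMonoidAlgebra.lift C C (GrothendieckAddGroup Γ) 1 (gradingCoaction 𝒜 C r) =
      algebraMap R C r := by
  induction r using DirectSum.Decomposition.inductionOn 𝒜 with
  | zero => simp
  | homogeneous m => simp [gradingCoaction_of_mem 𝒜 C m.2]
  | add a b ha hb => rw [map_add, map_add, map_add, ha, hb]

theorem gradingCoaction_injective (h : Function.Injective (algebraMap R C)) :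
    Function.Injective (gradingCoaction 𝒜 C) := by
  intro a b hab
  apply h
  rw [← lift_one_gradingCoaction 𝒜 C, ← lift_one_gradingCoaction 𝒜 C, hab]

theorem map_gradingCoaction {C C' : Type*} [CommRing C] [Algebra R C] [CommRing C'] [Algebra R C']
    (f : C →ₐ[R] C') (r : R) :
    AddMonoidAlgebra.mapRingHom _ (f : C →+* C') (gradingCoaction 𝒜 C r) =
      gradingCoaction 𝒜 C' r := by
  induction r using DirectSum.Decomposition.inductionOn 𝒜 with
  | zero => simp
  | homogeneous m =>
    rw [gradingCoaction_of_mem 𝒜 C m.2, gradingCoaction_of_mem 𝒜 C' m.2]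
    simp
  | add a b ha hb => rw [map_add, map_add, map_add, ha, hb]

theorem gradingCoaction_coeff_of [IsCancelAdd Γ] (r : R) (γ : Γ) :
    (gradingCoaction 𝒜 C r).coeff (GrothendieckAddGroup.of γ) =
      algebraMap R C (DirectSum.decompose 𝒜 r γ) := by
  induction r using DirectSum.Decomposition.inductionOn 𝒜 with
  | zero => simp
  | @homogeneous i m =>
    rw [gradingCoaction_of_mem 𝒜 C m.2]
    by_cases h : i = γ
    · subst h; simp
    · rw [DirectSum.decompose_of_mem_ne 𝒜 m.2 h]
      rw [AddMonoidAlgebra.coeff_single, Finsupp.single_apply,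
        if_neg fun h' => h (GrothendieckAddGroup.of_injective h')]
      simp
  | add a b ha hb =>
    rw [map_add, AddMonoidAlgebra.coeff_add, Finsupp.add_apply, ha, hb, DirectSum.decompose_add,
      DirectSum.add_apply, AddSubgroup.coe_add, map_add]

theorem gradingCoaction_coeff_of_notMem_range (r : R) {g : GrothendieckAddGroup Γ}
    (hg : ∀ γ : Γ, GrothendieckAddGroup.of γ ≠ g) : (gradingCoaction 𝒜 C r).coeff g = 0 := by
  induction r using DirectSum.Decomposition.inductionOn 𝒜 with
  | zero => simp
  | @homogeneous i m =>
    rw [gradingCoaction_of_mem 𝒜 C m.2]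
    rw [AddMonoidAlgebra.coeff_single, Finsupp.single_apply, if_neg (hg i)]
  | add a b ha hb =>
    rw [map_add, AddMonoidAlgebra.coeff_add, Finsupp.add_apply, ha, hb, add_zero]

end

instance grothendieckAddGroup_uniqueSums (Γ : Type*) [AddCommMonoid Γ] [IsCancelAdd Γ]
    [IsAddTorsionFree Γ] : UniqueSums (GrothendieckAddGroup Γ) :=
  uniqueSums_of_isAddTorsionFree _

theorem mem_gradedQuotientField_of_mem_component [IsCancelAdd Γ] [IsDomain R]
    {K : Type*} [Field K] [Algebra R K] [IsFractionRing R K]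
    {α : GrothendieckAddGroup Γ} {x : K}
    (hx : x ∈ gradedQuotientComponent 𝒜 K α) : x ∈ gradedQuotientField 𝒜 K := by
  rcases hx with (rfl | ⟨β, γ, f, g, hf, hg, h0, hα, rfl⟩)
  · exact zero_mem _
  · exact ⟨f, g, ⟨⟨γ, hg⟩, mem_nonZeroDivisors_of_ne_zero h0⟩, div_eq_mul_inv _ _⟩

/-- The homogeneous elements of `R_H` that belong to `T`. -/
def homogeneousElements [IsCancelAdd Γ] [IsDomain R] {K : Type*} [Field K]
    [Algebra R K] [IsFractionRing R K] (T : Subalgebra R K) : Set K :=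
  {x | x ∈ T ∧ ∃ α, x ∈ gradedQuotientComponent 𝒜 K α}

theorem mem_closure_homogeneousElements [IsCancelAdd Γ] [IsDomain R] {K : Type*} [Field K]
    [Algebra R K] [IsFractionRing R K] (T : Subalgebra R K) [GradedRing (overringGrading 𝒜 K T)]
    {t : K} (ht : t ∈ T) : t ∈ AddSubgroup.closure (homogeneousElements 𝒜 T) := by
  classical
  have := DirectSum.sum_support_decompose (overringGrading 𝒜 K T) ⟨t, ht⟩
  have h2 := congrArg T.val this
  rw [map_sum] at h2
  change _ = t at h2
  rw [← h2]
  refine AddSubgroup.sum_mem _ fun α _ => AddSubgroup.subset_closure ⟨SetLike.coe_mem _, α, ?_⟩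
  exact (DirectSum.decompose (overringGrading 𝒜 K T) ⟨t, ht⟩ α).2

variable [IsCancelAdd Γ] [IsAddTorsionFree Γ]
  (K : Type*) [Field K] [Algebra R K] [IsFractionRing R K]

/-- The coaction, extended to the fraction field of `R`. -/
noncomputable def fractionCoaction (C : Type*) [CommRing C] [IsDomain C] [Algebra R C]
    [FaithfulSMul R C] :
    K →+* FractionRing (AddMonoidAlgebra C (GrothendieckAddGroup Γ)) :=
  IsFractionRing.lift (A := R)
    (g := (algebraMap (AddMonoidAlgebra C (GrothendieckAddGroup Γ)) (FractionRing _)).comp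
      (gradingCoaction 𝒜 C))
    ((IsFractionRing.injective _ _).comp
      (gradingCoaction_injective 𝒜 C (FaithfulSMul.algebraMap_injective R C)))

theorem fractionCoaction_algebraMap (C : Type*) [CommRing C] [IsDomain C] [Algebra R C]
    [FaithfulSMul R C] (r : R) :
    fractionCoaction 𝒜 K C (algebraMap R K r) = algebraMap _ _ (gradingCoaction 𝒜 C r) :=
  IsFractionRing.lift_algebraMap _ _

theorem algebraMap_eq_fractionCoaction_div_iff (C : Type*) [CommRing C] [IsDomain C] [Algebra R C]
    [FaithfulSMul R C] {a b : R} (hb : b ≠ 0)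
    (y : AddMonoidAlgebra C (GrothendieckAddGroup Γ)) :
    algebraMap _ _ y = fractionCoaction 𝒜 K C (algebraMap R K a / algebraMap R K b) ↔
      y * gradingCoaction 𝒜 C b = gradingCoaction 𝒜 C a := by
  have h := gradingCoaction_injective 𝒜 C (FaithfulSMul.algebraMap_injective R C)
  rw [map_div₀, fractionCoaction_algebraMap, fractionCoaction_algebraMap, eq_div_iff, ← map_mul,
    (IsFractionRing.injective (AddMonoidAlgebra C (GrothendieckAddGroup Γ))
      (FractionRing _)).eq_iff]
  rw [ne_eq, FaithfulSMul.algebraMap_eq_zero_iff, map_eq_zero_iff _ h]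
  exact hb

variable [IsDomain R]

/-- Homogeneous elements are the eigenvectors of the coaction. This makes closure under products and
inverses, and independence of the components, formal. -/
theorem mem_gradedQuotientComponent_iff {α : GrothendieckAddGroup Γ} {x : K} :
    x ∈ gradedQuotientComponent 𝒜 K α ↔
      algebraMap _ _ (AddMonoidAlgebra.single α x) = fractionCoaction 𝒜 K K x := by
  classical
  constructor
  · rintro (rfl | ⟨β, γ, f, g, hf, hg, h0, hα, rfl⟩)
    · simp
    · have : algebraMap R K g ≠ 0 := by simpa using h0
      rw [algebraMap_eq_fractionCoaction_div_iff 𝒜 K K h0, gradingCoaction_of_mem 𝒜 K hf,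
        gradingCoaction_of_mem 𝒜 K hg, AddMonoidAlgebra.single_mul_single,
        div_mul_cancel₀ _ this, ← hα, sub_add_cancel]
  · intro h
    obtain ⟨a, b, hb, rfl⟩ := IsFractionRing.div_surjective (A := R) x
    have hb0 := nonZeroDivisors.ne_zero hb
    rw [algebraMap_eq_fractionCoaction_div_iff 𝒜 K K hb0] at h
    -- With x = a/b, compare coefficients in degree α + γ, where b_γ ≠ 0: x b_γ is the component of
    -- a in that degree, or 0 if α + γ ∉ Γ.
    obtain ⟨γ, hγ⟩ : ∃ γ, (DirectSum.decompose 𝒜 b γ : R) ≠ 0 := by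
      by_contra! hc
      apply hb0
      rw [← DirectSum.sum_support_decompose 𝒜 b]
      exact Finset.sum_eq_zero fun i _ => hc i
    have hK : algebraMap R K (DirectSum.decompose 𝒜 b γ) ≠ 0 := by simpa using hγ
    have h2 := congrArg (fun z => z.coeff (α + GrothendieckAddGroup.of γ)) h
    simp only [AddMonoidAlgebra.coeff_single_mul_add, gradingCoaction_coeff_of] at h2
    by_cases hδ : ∃ δ : Γ, GrothendieckAddGroup.of δ = α + GrothendieckAddGroup.of γ
    · obtain ⟨δ, hδ⟩ := hδ
      rw [← hδ, gradingCoaction_coeff_of] at h2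
      exact Or.inr ⟨δ, γ, _, _, SetLike.coe_mem _, SetLike.coe_mem _, hγ,
        by rw [hδ, add_sub_cancel_right], eq_div_of_mul_eq hK h2⟩
    · push Not at hδ
      rw [gradingCoaction_coeff_of_notMem_range 𝒜 K a hδ] at h2
      exact Or.inl ((mul_eq_zero.1 h2).resolve_right hK)

variable {K}

theorem algebraMap_mem_gradedQuotientComponent {γ : Γ} {r : R} (hr : r ∈ 𝒜 γ) :
    algebraMap R K r ∈ gradedQuotientComponent 𝒜 K (GrothendieckAddGroup.of γ) := by
  rw [mem_gradedQuotientComponent_iff, fractionCoaction_algebraMap, gradingCoaction_of_mem 𝒜 K hr]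

theorem one_mem_gradedQuotientComponent : (1 : K) ∈ gradedQuotientComponent 𝒜 K 0 := by
  rw [mem_gradedQuotientComponent_iff, map_one, ← AddMonoidAlgebra.one_def, map_one]

theorem mul_mem_gradedQuotientComponent {α β : GrothendieckAddGroup Γ} {x y : K}
    (hx : x ∈ gradedQuotientComponent 𝒜 K α) (hy : y ∈ gradedQuotientComponent 𝒜 K β) :
    x * y ∈ gradedQuotientComponent 𝒜 K (α + β) := by
  rw [mem_gradedQuotientComponent_iff] at hx hy ⊢
  rw [map_mul, ← hx, ← hy, ← map_mul, AddMonoidAlgebra.single_mul_single]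

theorem inv_mem_gradedQuotientComponent {α : GrothendieckAddGroup Γ} {x : K}
    (hx : x ∈ gradedQuotientComponent 𝒜 K α) : x⁻¹ ∈ gradedQuotientComponent 𝒜 K (-α) := by
  rcases eq_or_ne x 0 with rfl | h0
  · rw [inv_zero]; exact zero_mem _
  rw [mem_gradedQuotientComponent_iff] at hx ⊢
  rw [map_inv₀, ← hx]
  refine eq_inv_of_mul_eq_one_left ?_
  rw [← map_mul, AddMonoidAlgebra.single_mul_single, inv_mul_cancel₀ h0, neg_add_cancel,
    ← AddMonoidAlgebra.one_def, map_one]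

variable (K) in
-- A relation among components is carried by the coaction to a relation among distinct powers of t
-- over K.
theorem directSum_coe_injective (T : Subalgebra R K) :
    Function.Injective (DirectSum.coeAddMonoidHom (overringGrading 𝒜 K T)) := by
  let e : (DirectSum (GrothendieckAddGroup Γ) fun α => overringGrading 𝒜 K T α) →+
      AddMonoidAlgebra K (GrothendieckAddGroup Γ) :=
    DirectSum.toAddMonoid fun α => (AddMonoidAlgebra.singleAddHom α).comp
      ((T.val : T →+ K).comp (overringGrading 𝒜 K T α).subtype)
  have he : ∀ x α, (e x).coeff α = ((x α : T) : K) := by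
    intro x α
    induction x using DirectSum.induction_on with
    | zero => simp
    | of i x =>
      by_cases h : i = α
      · subst h; simp [e]
      · rw [DirectSum.of_eq_of_ne _ _ _ (Ne.symm h)]
        simp [e, h]
    | add x y hx hy => rw [map_add, AddMonoidAlgebra.coeff_add, Finsupp.add_apply, hx, hy]; rfl
  have hinj : Function.Injective e := by
    intro x y hxy
    refine DFinsupp.ext fun α => ?_
    apply Subtype.ext
    apply Subtype.ext
    rw [← he, ← he, hxy]
  have hcomm : ∀ x, algebraMap _ (FractionRing _) (e x) =
      fractionCoaction 𝒜 K K (DirectSum.coeAddMonoidHom (overringGrading 𝒜 K T) x : T) := by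
    intro x
    induction x using DirectSum.induction_on with
    | zero => simp
    | of i x =>
      have := (mem_gradedQuotientComponent_iff 𝒜 K).1 x.2
      simpa [e] using this
    | add x y hx hy => simp only [map_add, hx, hy, AddMemClass.coe_add]
  intro x y hxy
  apply hinj
  apply IsFractionRing.injective _ (FractionRing (AddMonoidAlgebra K (GrothendieckAddGroup Γ)))
  rw [hcomm, hcomm, hxy]

/-- Independence and multiplicativity of the components are automatic, so only additive generation
by homogeneous elements has to be checked. -/
theorem isGradedOverring_of_le_closure {T : Subalgebra R K}
    (h : ∀ t ∈ T, t ∈ AddSubgroup.closure (homogeneousElements 𝒜 T)) :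
    IsGradedOverring 𝒜 K T := by
  refine ⟨fun t ht => ?_, ?_⟩
  · have : AddSubgroup.closure (homogeneousElements 𝒜 T) ≤
        (gradedQuotientField 𝒜 K).toSubring.toAddSubgroup := by
      rw [AddSubgroup.closure_le]
      rintro x ⟨-, α, hx⟩
      exact mem_gradedQuotientField_of_mem_component 𝒜 hx
    exact this (h t ht)
  · have hint : DirectSum.IsInternal (overringGrading 𝒜 K T) := by
      refine ⟨directSum_coe_injective 𝒜 K T, fun t => ?_⟩
      have hle : AddSubgroup.closure (homogeneousElements 𝒜 T) ≤
          ((DirectSum.coeAddMonoidHom (overringGrading 𝒜 K T)).range).map (T.val : T →+ K) := by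
        rw [AddSubgroup.closure_le]
        rintro x ⟨hxT, α, hx⟩
        exact ⟨⟨x, hxT⟩, ⟨DirectSum.of (fun i => overringGrading 𝒜 K T i) α ⟨⟨x, hxT⟩, hx⟩,
          by simp⟩, rfl⟩
      obtain ⟨t', ⟨z, hz⟩, ht'⟩ := hle (h t t.2)
      exact ⟨z, hz.trans (Subtype.ext ht')⟩
    exact ⟨{ hint.chooseDecomposition with
      one_mem := one_mem_gradedQuotientComponent 𝒜
      mul_mem := fun _ _ _ _ hx hy => mul_mem_gradedQuotientComponent 𝒜 hx hy }⟩

theorem isGradedOverring_adjoin {S : Set K}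
    (hS : ∀ x ∈ S, ∃ α, x ∈ gradedQuotientComponent 𝒜 K α) :
    IsGradedOverring 𝒜 K (Algebra.adjoin R S) := by
  classical
  apply isGradedOverring_of_le_closure
  let M : Submonoid K :=
    { carrier := homogeneousElements 𝒜 (Algebra.adjoin R S)
      one_mem' := ⟨one_mem _, 0, one_mem_gradedQuotientComponent 𝒜⟩
      mul_mem' := fun ⟨h, α, hα⟩ ⟨h', β, hβ⟩ =>
        ⟨mul_mem h h', α + β, mul_mem_gradedQuotientComponent 𝒜 hα hβ⟩ }
  have hM : ∀ x, x ∈ Subring.closure (M : Set K) ↔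
      x ∈ AddSubgroup.closure (homogeneousElements 𝒜 (Algebra.adjoin R S)) := by
    intro x
    rw [Subring.mem_closure_iff, Submonoid.closure_eq]
    rfl
  intro t ht
  rw [← hM]
  have hle : Algebra.adjoin R S ≤
      { Subring.closure (M : Set K) with
        algebraMap_mem' := fun r => (hM _).2 <| by
          rw [← DirectSum.sum_support_decompose 𝒜 r, map_sum]
          exact AddSubgroup.sum_mem _ fun γ _ => AddSubgroup.subset_closure
            ⟨Subalgebra.algebraMap_mem _ _, _,
              algebraMap_mem_gradedQuotientComponent 𝒜 (SetLike.coe_mem _)⟩ } := by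
    refine Algebra.adjoin_le fun x hx => Subring.subset_closure ⟨Algebra.subset_adjoin hx, hS x hx⟩
  exact hle ht

theorem isGradedOverring_integralClosure : IsGradedOverring 𝒜 K (integralClosure R K) := by
  apply isGradedOverring_of_le_closure
  intro x hx
  have hcl : IsIntegrallyClosed (integralClosure R K) :=
    (isIntegrallyClosed_iff_isIntegrallyClosedIn K).2 inferInstance
  obtain ⟨a, b, hb, rfl⟩ := IsFractionRing.div_surjective (A := R) x
  have hb0 := nonZeroDivisors.ne_zero hb
  have hbK : algebraMap R K b ≠ 0 := by simpa using hb0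
  let G := GrothendieckAddGroup Γ
  let C := integralClosure R K
  have := isIntegrallyClosed_addMonoidAlgebra C G
  obtain ⟨p, hp, hpx⟩ := hx
  have hint : IsIntegral (AddMonoidAlgebra C G)
      (fractionCoaction 𝒜 K C (algebraMap R K a / algebraMap R K b)) := by
    refine ⟨p.map (gradingCoaction 𝒜 C), hp.map _, ?_⟩
    have := congrArg (fractionCoaction 𝒜 K C) hpx
    rw [Polynomial.hom_eval₂, map_zero] at this
    rw [Polynomial.eval₂_map, ← this]
    congr 1
    exact (RingHom.ext fun r => fractionCoaction_algebraMap 𝒜 K C r).symm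
  obtain ⟨y, hy⟩ := IsIntegrallyClosed.isIntegral_iff.1 hint
  rw [algebraMap_eq_fractionCoaction_div_iff 𝒜 K C hb0] at hy
  -- Y is the coaction of x, with coefficients known to be integral. It remains to show that the
  -- coefficient at g is homogeneous of degree g.
  let Y : AddMonoidAlgebra K G := AddMonoidAlgebra.mapRingHom G ((C.val : C →ₐ[R] K) : C →+* K) y
  have hY : Y * gradingCoaction 𝒜 K b = gradingCoaction 𝒜 K a := by
    rw [← map_gradingCoaction 𝒜 C.val, ← map_gradingCoaction 𝒜 C.val, ← hy, map_mul]
  let F := FractionRing (AddMonoidAlgebra K G)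
  -- Coassociativity: u applies the coaction to coefficients, v sends k t^g to (k t^g) t^g. They
  -- agree on the coaction of R, hence on its quotient Y, and coefficientwise this is the
  -- eigenvector criterion.
  let u : AddMonoidAlgebra K G →+* AddMonoidAlgebra F G :=
    AddMonoidAlgebra.mapRingHom G (fractionCoaction 𝒜 K K)
  let v : AddMonoidAlgebra K G →+* AddMonoidAlgebra F G :=
    AddMonoidAlgebra.liftNCRingHom
      ((AddMonoidAlgebra.singleZeroRingHom (R := F) (M := G)).comp
        ((algebraMap (AddMonoidAlgebra K G) F).comp AddMonoidAlgebra.singleZeroRingHom))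
      ({ toFun := fun m => AddMonoidAlgebra.single m.toAdd
            (algebraMap (AddMonoidAlgebra K G) F (AddMonoidAlgebra.single m.toAdd 1))
         map_one' := by
          rw [toAdd_one, ← AddMonoidAlgebra.one_def, map_one, ← AddMonoidAlgebra.one_def]
         map_mul' := fun m n => by
          rw [toAdd_mul, AddMonoidAlgebra.single_mul_single, ← map_mul,
            AddMonoidAlgebra.single_mul_single, one_mul] } : Multiplicative G →* _)
      (fun _ _ => Commute.all _ _)
  have hv : ∀ g k, v (AddMonoidAlgebra.single g k) = AddMonoidAlgebra.single g
      (algebraMap (AddMonoidAlgebra K G) F (AddMonoidAlgebra.single g k)) := by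
    intro g k
    simp only [v, AddMonoidAlgebra.liftNCRingHom_single]
    simp [AddMonoidAlgebra.single_mul_single, ← map_mul]
  have huv : ∀ r, u (gradingCoaction 𝒜 K r) = v (gradingCoaction 𝒜 K r) := by
    intro r
    induction r using DirectSum.Decomposition.inductionOn 𝒜 with
    | zero => simp
    | homogeneous m =>
      rw [gradingCoaction_of_mem 𝒜 K m.2, hv, AddMonoidAlgebra.mapRingHom_single,
        fractionCoaction_algebraMap, gradingCoaction_of_mem 𝒜 K m.2]
    | add a b ha hb => rw [map_add, map_add, map_add, ha, hb]
  have hu : Function.Injective u :=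
    AddMonoidAlgebra.map_injective (fractionCoaction 𝒜 K K).toAddMonoidHom
      (fractionCoaction 𝒜 K K).injective
  have huY : u Y = v Y := by
    have h0 : u (gradingCoaction 𝒜 K b) ≠ 0 := by
      rw [Ne, map_eq_zero_iff u hu, map_eq_zero_iff _
        (gradingCoaction_injective 𝒜 K (FaithfulSMul.algebraMap_injective R K))]
      exact hb0
    apply mul_right_cancel₀ h0
    rw [← map_mul, hY, huv, huv, ← map_mul, hY]
  have hvc : ∀ Z : AddMonoidAlgebra K G, ∀ g, (v Z).coeff g =
      algebraMap (AddMonoidAlgebra K G) F (AddMonoidAlgebra.single g (Z.coeff g)) := by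
    intro Z g
    induction Z using AddMonoidAlgebra.induction_linear with
    | zero => simp
    | add x y hx hy =>
      rw [map_add, AddMonoidAlgebra.coeff_add, Finsupp.add_apply, hx, hy,
        AddMonoidAlgebra.coeff_add, Finsupp.add_apply, AddMonoidAlgebra.single_add, map_add]
    | single h k =>
      rw [hv]
      by_cases e : h = g
      · subst e; simp
      · simp [e]
  have hcoeff : ∀ g, Y.coeff g ∈ gradedQuotientComponent 𝒜 K g := by
    intro g
    rw [mem_gradedQuotientComponent_iff, ← hvc, ← huY]
    exact AddMonoidAlgebra.coeff_mapRingHom _ _ _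
  have hcoeff' : ∀ g, Y.coeff g ∈ integralClosure R K := by
    intro g
    simp only [Y, AddMonoidAlgebra.coeff_mapRingHom]
    exact (y.coeff g).2
  have hx : algebraMap R K a / algebraMap R K b =
      AddMonoidAlgebra.lift K K G 1 Y := by
    rw [div_eq_iff hbK, ← lift_one_gradingCoaction 𝒜 K a, ← lift_one_gradingCoaction 𝒜 K b, ← hY,
      map_mul]
  rw [hx, AddMonoidAlgebra.lift_apply]
  refine AddSubgroup.sum_mem _ fun g _ => AddSubgroup.subset_closure ?_
  simpa using ⟨hcoeff' g, g, hcoeff g⟩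

end Coaction

/-! ### Criteria for invertibility -/

section Invertible

variable {A : Type*} [CommRing A]

/-- Write 1 = f j₁ + g j₂ with j₁, j₂ in the inverse ideal, and take p = f j₁, q = g j₁, r = f j₂, s
= g j₂. -/
theorem exists_of_isUnit_span_pair {f g : A}
    (h : IsUnit (Ideal.span {f, g} : FractionalIdeal A⁰ (FractionRing A))) :
    ∃ p q r s : A, p + s = 1 ∧ f * q = g * p ∧ f * s = g * r := by
  let F := FractionRing A
  let I : FractionalIdeal A⁰ F := (Ideal.span {f, g} : Ideal A)
  obtain ⟨J, hJ⟩ := isUnit_iff_exists_inv.1 h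
  have hmem : ∀ a ∈ Ideal.span {f, g}, ∀ j ∈ J, ∃ b : A, algebraMap A F b = algebraMap A F a * j := by
    intro a ha j hj
    rw [← FractionalIdeal.mem_one_iff A⁰, ← hJ]
    exact FractionalIdeal.mul_mem_mul (FractionalIdeal.mem_coeIdeal_of_mem A⁰ ha) hj
  have h1 : ∃ j₁ ∈ J, ∃ j₂ ∈ J, (1 : F) = algebraMap A F f * j₁ + algebraMap A F g * j₂ := by
    have h1 : (1 : F) ∈ I * J := hJ ▸ FractionalIdeal.one_mem_one A⁰
    refine FractionalIdeal.mul_induction_on (C := fun x => ∃ j₁ ∈ J, ∃ j₂ ∈ J,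
      x = algebraMap A F f * j₁ + algebraMap A F g * j₂) h1 ?_ ?_
    · intro i hi j hj
      obtain ⟨i', hi', rfl⟩ := (FractionalIdeal.mem_coeIdeal A⁰).1 hi
      obtain ⟨c, d, rfl⟩ := Ideal.mem_span_pair.1 hi'
      refine ⟨c • j, Submodule.smul_mem (J : Submodule A F) c hj, d • j,
        Submodule.smul_mem (J : Submodule A F) d hj, ?_⟩
      rw [map_add, map_mul, map_mul, Algebra.smul_def, Algebra.smul_def]
      ring
    · rintro x y ⟨a, ha, b, hb, rfl⟩ ⟨a', ha', b', hb', rfl⟩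
      exact ⟨a + a', Submodule.add_mem (J : Submodule A F) ha ha', b + b',
        Submodule.add_mem (J : Submodule A F) hb hb', by ring⟩
  obtain ⟨j₁, hj₁, j₂, hj₂, h1⟩ := h1
  have hf : f ∈ Ideal.span {f, g} := Ideal.subset_span (by simp)
  have hg : g ∈ Ideal.span {f, g} := Ideal.subset_span (by simp)
  obtain ⟨p, hp⟩ := hmem f hf j₁ hj₁
  obtain ⟨q, hq⟩ := hmem g hg j₁ hj₁
  obtain ⟨r, hr⟩ := hmem f hf j₂ hj₂
  obtain ⟨s, hs⟩ := hmem g hg j₂ hj₂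
  have hinj := IsFractionRing.injective A F
  refine ⟨p, q, r, s, hinj ?_, hinj ?_, hinj ?_⟩
  · rw [map_add, hp, hs, map_one, h1]
  · rw [map_mul, map_mul, hp, hq]; ring
  · rw [map_mul, map_mul, hr, hs]; ring

variable [IsDomain A]

/-- If g divides s f for all generators f, then s/g ∈ I⁻¹, so s = g (s/g) lies in I I⁻¹. -/
theorem isUnit_coeIdeal_span {S : Finset A} {g₀ : A} (hg₀ : g₀ ∈ S) (hS0 : ∀ g ∈ S, g ≠ 0)
    (h : Ideal.span {s : A | ∃ g ∈ S, ∀ f ∈ S, g ∣ s * f} = ⊤) :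
    IsUnit (Ideal.span (S : Set A) : FractionalIdeal A⁰ (FractionRing A)) := by
  let F := FractionRing A
  let I : FractionalIdeal A⁰ F := (Ideal.span (S : Set A) : Ideal A)
  have hI0 : I ≠ 0 := by
    rw [FractionalIdeal.coeIdeal_ne_zero]
    intro hb
    exact hS0 g₀ hg₀ (Ideal.span_eq_bot.1 hb g₀ hg₀)
  rw [← FractionalIdeal.mul_inv_cancel_iff_isUnit]
  refine le_antisymm ?_ ?_
  · rw [FractionalIdeal.inv_eq]; exact FractionalIdeal.mul_one_div_le_one
  rw [FractionalIdeal.one_le]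
  have hle : Ideal.span {s : A | ∃ g ∈ S, ∀ f ∈ S, g ∣ s * f} ≤
      
      ((I * I⁻¹ : FractionalIdeal A⁰ F) : Submodule A F).comap (Algebra.linearMap A F) := by
    rw [Ideal.span_le]
    rintro s ⟨g, hg, hs⟩
    have hgF : algebraMap A F g ≠ 0 := by simpa using hS0 g hg
    have hinv : algebraMap A F s / algebraMap A F g ∈ I⁻¹ := by
      rw [FractionalIdeal.mem_inv_iff hI0]
      intro y hy
      obtain ⟨y', hy', rfl⟩ := (FractionalIdeal.mem_coeIdeal A⁰).1 hy
      have hd : g ∣ s * y' := by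
        have : Ideal.span (S : Set A) ≤ Submodule.comap (LinearMap.mulLeft A s) (Ideal.span {g}) := by
          rw [Ideal.span_le]
          intro f hf
          exact Ideal.mem_span_singleton.2 (hs f hf)
        exact Ideal.mem_span_singleton.1 (this hy')
      obtain ⟨c, hc⟩ := hd
      rw [FractionalIdeal.mem_one_iff]
      refine ⟨c, ?_⟩
      rw [div_mul_eq_mul_div, eq_div_iff hgF, ← map_mul, ← map_mul, hc, mul_comm]
    have := FractionalIdeal.mul_mem_mul (I := I)
      (FractionalIdeal.mem_coeIdeal_of_mem A⁰ (Ideal.subset_span hg)) hinv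
    rw [mul_div_cancel₀ _ hgF] at this
    exact this
  have h1 : (1 : A) ∈ Ideal.span {s : A | ∃ g ∈ S, ∀ f ∈ S, g ∣ s * f} := h ▸ Submodule.mem_top
  have h2 := hle h1
  rw [Submodule.mem_comap, Algebra.linearMap_apply, map_one] at h2
  exact h2

end Invertible

/-! ### From comparability at homogeneous primes to gr-Prüfer -/

section GradedPrufer

variable {Δ A : Type*} [CommRing A] [AddCommGroup Δ] [DecidableEq Δ]
  (ℬ : Δ → AddSubgroup A) [GradedRing ℬ]

theorem exists_finset_homogeneous_span_eq {I : Ideal A} (hfg : I.FG) (hI : I.IsHomogeneous ℬ) :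
    ∃ S : Finset A, (∀ f ∈ S, f ≠ 0 ∧ SetLike.IsHomogeneousElem ℬ f) ∧
      Ideal.span (S : Set A) = I := by
  classical
  obtain ⟨S, hS⟩ := hfg
  let S' : Finset A := (S.biUnion fun x => (DirectSum.decompose ℬ x).support.image fun i =>
    (DirectSum.decompose ℬ x i : A)).filter (· ≠ 0)
  have hmem : ∀ f ∈ S', f ≠ 0 ∧ ∃ x ∈ S, ∃ i, (DirectSum.decompose ℬ x i : A) = f := by
    intro f hf
    simp only [S', Finset.mem_filter, Finset.mem_biUnion, Finset.mem_image] at hf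
    obtain ⟨⟨x, hx, i, -, hi⟩, h0⟩ := hf
    exact ⟨h0, x, hx, i, hi⟩
  refine ⟨S', fun f hf => ?_, le_antisymm ?_ ?_⟩
  · obtain ⟨h0, x, -, i, rfl⟩ := hmem f hf
    exact ⟨h0, i, SetLike.coe_mem _⟩
  · rw [Ideal.span_le]
    intro f hf
    obtain ⟨-, x, hx, i, rfl⟩ := hmem f hf
    exact hI i (hS ▸ Ideal.subset_span hx)
  · rw [← hS]
    refine Ideal.span_le.2 fun x hx => ?_
    rw [← DirectSum.sum_support_decompose ℬ x]
    refine Ideal.sum_mem _ fun i hi => Ideal.subset_span ?_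
    simp only [S', Finset.coe_filter, Set.mem_ofPred_eq, Finset.mem_biUnion, Finset.mem_image]
    exact ⟨⟨x, hx, i, hi, rfl⟩, fun h => DFinsupp.mem_support_iff.1 hi (Subtype.ext h)⟩

/-- Divisibility up to a factor outside M is transitive, so a finite nonempty set on which it is
total has an element dividing all the others. -/
theorem exists_dvd_mul_of_comparable {M : Ideal A} (hM : M.IsPrime) {S : Finset A}
    (hS : S.Nonempty)
    (h : ∀ f ∈ S, ∀ g ∈ S, (∃ s ∉ M, g ∣ s * f) ∨ ∃ s ∉ M, f ∣ s * g) :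
    ∃ g ∈ S, ∃ s ∉ M, ∀ f ∈ S, g ∣ s * f := by
  classical
  induction hS using Finset.Nonempty.cons_induction with
  | singleton a => exact ⟨a, by simp, 1, fun h1 => hM.ne_top ((Ideal.eq_top_iff_one _).2 h1), by simp⟩
  | cons a S ha hS ih =>
    obtain ⟨g, hg, s, hs, hgs⟩ := ih fun f hf g hg =>
      h f (Finset.mem_cons_of_mem hf) g (Finset.mem_cons_of_mem hg)
    rcases h a (Finset.mem_cons_self _ _) g (Finset.mem_cons_of_mem hg) with
      ⟨t, ht, hd⟩ | ⟨t, ht, hd⟩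
    · refine ⟨g, Finset.mem_cons_of_mem hg, s * t, fun hc => (hM.mem_or_mem hc).elim hs ht, ?_⟩
      intro f hf
      rcases Finset.mem_cons.1 hf with rfl | hf
      · rw [mul_assoc]; exact hd.mul_left _
      · rw [mul_comm s t, mul_assoc]; exact (hgs f hf).mul_left _
    · refine ⟨a, Finset.mem_cons_self _ _, t * s, fun hc => (hM.mem_or_mem hc).elim ht hs, ?_⟩
      intro f hf
      rcases Finset.mem_cons.1 hf with rfl | hf
      · exact dvd_mul_left _ _
      · obtain ⟨c, hc⟩ := hgs f hf
        rw [mul_assoc, hc, ← mul_assoc]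
        exact hd.mul_right _

/-- Invertibility is tested at maximal ideals M, which need not be homogeneous; comparability is
available at the homogeneous core P of M and is transferred to M. -/
theorem isGradedPrufer_of_comparable [IsDomain A] [IsAddTorsionFree Δ]
    (h : ∀ P : Ideal A, P.IsPrime → P.IsHomogeneous ℬ → ∀ f g : A, f ≠ 0 → g ≠ 0 →
      SetLike.IsHomogeneousElem ℬ f → SetLike.IsHomogeneousElem ℬ g →
      (∃ s ∉ P, g ∣ s * f) ∨ ∃ s ∉ P, f ∣ s * g) : IsGradedPrufer ℬ := by
  classical
  intro I hI0 hfg hI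
  obtain ⟨S, hS, rfl⟩ := exists_finset_homogeneous_span_eq ℬ hfg hI
  have hne : S.Nonempty := by
    rw [Finset.nonempty_iff_ne_empty]
    rintro rfl
    exact hI0 (by simp)
  obtain ⟨g₀, hg₀⟩ := hne
  refine isUnit_coeIdeal_span hg₀ (fun g hg => (hS g hg).1) ?_
  by_contra htop
  obtain ⟨M, hM, hle⟩ := Ideal.exists_le_maximal _ htop
  have hMp := hM.isPrime
  have hP := isPrime_homogeneousCore ℬ hMp
  have key : ∀ f g s : A, SetLike.IsHomogeneousElem ℬ f → SetLike.IsHomogeneousElem ℬ g →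
      s ∉ (M.homogeneousCore ℬ).toIdeal → g ∣ s * f → ∃ s ∉ M, g ∣ s * f := by
    rintro f g s ⟨i, hf⟩ hg hs hd
    obtain ⟨j, hj⟩ : ∃ j, (DirectSum.decompose ℬ s j : A) ∉ (M.homogeneousCore ℬ).toIdeal := by
      by_contra! hc
      apply hs
      rw [← DirectSum.sum_support_decompose ℬ s]
      exact Ideal.sum_mem _ fun i _ => hc i
    -- A component s_j outside P is outside M, being homogeneous. It still satisfies g ∣ s_j f,
    -- since f and the ideal (g) are homogeneous.
    refine ⟨DirectSum.decompose ℬ s j, fun hc => hj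
      (Ideal.mem_homogeneousCore_of_homogeneous_of_mem ⟨j, SetLike.coe_mem _⟩ hc), ?_⟩
    have hhom : (Ideal.span {g}).IsHomogeneous ℬ :=
      Ideal.homogeneous_span ℬ _ (by rintro x rfl; exact hg)
    have := hhom (j + i) (Ideal.mem_span_singleton.2 hd)
    rw [DirectSum.coe_decompose_mul_add_of_right_mem ℬ hf] at this
    exact Ideal.mem_span_singleton.1 this
  obtain ⟨g, hg, s, hs, hgs⟩ := exists_dvd_mul_of_comparable hMp ⟨g₀, hg₀⟩
    (fun f hf g hg => by
      obtain ⟨hf0, hf⟩ := hS f hf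
      obtain ⟨hg0, hg⟩ := hS g hg
      exact (h _ hP (M.homogeneousCore ℬ).isHomogeneous f g hf0 hg0 hf hg).imp
        (fun ⟨s, hs, hd⟩ => key f g s hf hg hs hd) (fun ⟨s, hs, hd⟩ => key g f s hg hf hs hd))
  exact hs (hle (Ideal.subset_span ⟨g, hg, hgs⟩))

end GradedPrufer

/-! ### Elements satisfying a polynomial with a coefficient outside P -/

section Comparison

variable {D K : Type*} [CommRing D] [Field K] [Algebra D K]

/-- For leading coefficient a, b = a x is integral, hence in D. If a ∉ P then x = b/a ∈ D_P; if b ∉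
P then x⁻¹ = a/b ∈ D_P; if both lie in P the degree can be lowered. -/
theorem mem_or_inv_mem_of_coeff_notMem [FaithfulSMul D K] [IsIntegrallyClosedIn D K] {P : Ideal D}
    (x : K) (n : ℕ) :
    ∀ p : Polynomial D, p.natDegree ≤ n → Polynomial.aeval x p = 0 → (∃ i, p.coeff i ∉ P) →
    (∃ s ∉ P, ∃ d, algebraMap D K s * x = algebraMap D K d) ∨
      ∃ s ∉ P, ∃ t, algebraMap D K s = algebraMap D K t * x := by
  induction n with
  | zero =>
    intro p hp h0 ⟨i, hi⟩
    rw [Polynomial.eq_C_of_natDegree_le_zero hp] at h0 hi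
    rw [Polynomial.aeval_C, FaithfulSMul.algebraMap_eq_zero_iff] at h0
    simp [h0] at hi
  | succ n ih =>
    intro p hp h0 ⟨i, hi⟩
    rcases hp.lt_or_eq with hlt | heq
    · exact ih p (Nat.lt_succ_iff.1 hlt) h0 ⟨i, hi⟩
    obtain ⟨b, hb⟩ := IsIntegrallyClosedIn.isIntegral_iff.1 (isIntegral_leadingCoeff_smul p x h0)
    rw [Algebra.smul_def] at hb
    by_cases ha : p.leadingCoeff ∈ P
    swap
    · exact Or.inl ⟨_, ha, b, hb.symm⟩
    by_cases hbP : b ∈ P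
    swap
    · exact Or.inr ⟨b, hbP, p.leadingCoeff, hb⟩
    -- Replace a x^(n+1) by b x^n. As a, b ∈ P, some coefficient stays outside P.
    refine ih (p.eraseLead + Polynomial.C b * Polynomial.X ^ n) ?_ ?_ ⟨i, ?_⟩
    · refine Polynomial.natDegree_add_le_of_degree_le ?_ (Polynomial.natDegree_C_mul_X_pow_le _ _)
      exact p.eraseLead_natDegree_le.trans (by omega)
    · have h2 := congrArg (Polynomial.aeval x) p.eraseLead_add_C_mul_X_pow
      simp only [map_add, map_mul, Polynomial.aeval_C, map_pow, Polynomial.aeval_X, heq, h0] at h2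
      simp only [map_add, map_mul, Polynomial.aeval_C, map_pow, Polynomial.aeval_X, hb]
      rw [← h2]
      ring
    · have hin : i ≠ n + 1 := by
        rintro rfl
        rw [← heq] at hi
        exact hi ha
      rw [Polynomial.coeff_add, Polynomial.eraseLead_coeff_of_ne _ (heq ▸ hin)]
      rw [Polynomial.coeff_C_mul_X_pow]
      split_ifs
      · exact fun hc => hi ((Submodule.add_mem_iff_left P hbP).1 hc)
      · rwa [add_zero]

end Comparison

/-! ### Homogeneous primes in graded overrings -/

section Overrings

variable {Γ R : Type*} [AddCommMonoid Γ] [IsCancelAdd Γ] [DecidableEq Γ]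
  [CommRing R] [IsDomain R] (𝒜 : Γ → AddSubgroup R) [GradedRing 𝒜]
  {K : Type*} [Field K] [Algebra R K] [IsFractionRing R K]

section Inclusion

variable {D T : Subalgebra R K} (hDT : D ≤ T)
  [GradedRing (overringGrading 𝒜 K D)] [GradedRing (overringGrading 𝒜 K T)]

theorem inclusion_decompose (x : D) (α : Algebra.GrothendieckAddGroup Γ) :
    (DirectSum.decompose (overringGrading 𝒜 K T) (Subalgebra.inclusion hDT x) α : T) =
      Subalgebra.inclusion hDT (DirectSum.decompose (overringGrading 𝒜 K D) x α) := by
  induction x using DirectSum.Decomposition.inductionOn (overringGrading 𝒜 K D) with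
  | zero => simp
  | @homogeneous i m =>
    have hm : Subalgebra.inclusion hDT (m : D) ∈ overringGrading 𝒜 K T i := m.2
    by_cases h : i = α
    · subst h
      rw [DirectSum.decompose_of_mem_same _ hm, DirectSum.decompose_of_mem_same _ m.2]
    · rw [DirectSum.decompose_of_mem_ne _ hm h, DirectSum.decompose_of_mem_ne _ m.2 h, map_zero]
  | add a b ha hb =>
    rw [map_add, DirectSum.decompose_add, DirectSum.decompose_add, DirectSum.add_apply,
      DirectSum.add_apply, AddSubgroup.coe_add, AddSubgroup.coe_add, map_add, ha, hb]

theorem isHomogeneous_comap_inclusion {I : Ideal T}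
    (hI : I.IsHomogeneous (overringGrading 𝒜 K T)) :
    (I.comap (Subalgebra.inclusion hDT)).IsHomogeneous (overringGrading 𝒜 K D) := by
  intro α x hx
  have := hI α (Ideal.mem_comap.1 hx)
  rw [inclusion_decompose 𝒜 hDT] at this
  exact this

theorem isHomogeneous_map_inclusion {I : Ideal D}
    (hI : I.IsHomogeneous (overringGrading 𝒜 K D)) :
    (I.map (Subalgebra.inclusion hDT)).IsHomogeneous (overringGrading 𝒜 K T) := by
  rw [← hI.toIdeal_homogeneousCore_eq_self]
  change (Ideal.map _ (Ideal.span _)).IsHomogeneous _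
  rw [Ideal.map_span]
  apply Ideal.homogeneous_span
  rintro _ ⟨_, ⟨⟨x, α, hx⟩, -, rfl⟩, rfl⟩
  exact ⟨α, hx⟩

/-- Take any prime lying over Q and pass to its homogeneous core; the contraction is still Q because
homogeneous elements generate Q. -/
theorem exists_homogeneous_prime_over [IsAddTorsionFree Γ] (hint : ∀ t ∈ T, IsIntegral D t)
    {Q : Ideal D} (hQ : Q.IsPrime) (hQh : Q.IsHomogeneous (overringGrading 𝒜 K D)) :
    ∃ P : Ideal T, P.IsPrime ∧ P.IsHomogeneous (overringGrading 𝒜 K T) ∧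
      P.comap (Subalgebra.inclusion hDT) = Q := by
  let _ : Algebra D T := (Subalgebra.inclusion hDT).toRingHom.toAlgebra
  have : IsScalarTower D T K := IsScalarTower.of_algebraMap_eq fun _ => rfl
  have : Algebra.IsIntegral D T := ⟨fun t =>
    (isIntegral_algebraMap_iff (FaithfulSMul.algebraMap_injective T K)).1 (hint t t.2)⟩
  obtain ⟨P, -, hP, hPQ⟩ := Ideal.exists_ideal_over_prime_of_isIntegral Q (⊥ : Ideal T) (by
    intro x hx
    have hx0 : Subalgebra.inclusion hDT x = 0 := hx
    have : x = 0 := Subalgebra.inclusion_injective hDT (hx0.trans (map_zero _).symm)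
    rw [this]
    exact zero_mem _)
  refine ⟨_, isPrime_homogeneousCore _ hP, (P.homogeneousCore _).isHomogeneous, le_antisymm ?_ ?_⟩
  · intro x hx
    rw [← hPQ]
    exact Ideal.toIdeal_homogeneousCore_le _ P hx
  · rw [← hQh.toIdeal_homogeneousCore_eq_self]
    refine Ideal.span_le.2 ?_
    rintro _ ⟨⟨x, α, hx⟩, hxQ, rfl⟩
    have hxQ : x ∈ Q := hxQ
    rw [← hPQ] at hxQ
    exact Ideal.mem_homogeneousCore_of_homogeneous_of_mem ⟨α, hx⟩ hxQ

variable {𝒜}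

/-- For homogeneous x = f/g in P₁, invertibility of (f, g) gives p = x q, r = x s and p + s = 1 in
D. Then p and r = x s lie in P₂; if s were in P₂, so would be 1, hence x ∈ P₂. -/
theorem IsGradedPrufer.le_of_comap_le [IsAddTorsionFree Γ]
    (hD : IsGradedPrufer (overringGrading 𝒜 K D))
    {P₁ P₂ : Ideal T} (h₂ : P₂.IsPrime)
    (hh : P₁.IsHomogeneous (overringGrading 𝒜 K T))
    (h : P₁.comap (Subalgebra.inclusion hDT) = P₂.comap (Subalgebra.inclusion hDT)) :
    P₁ ≤ P₂ := by
  rw [← hh.toIdeal_homogeneousCore_eq_self]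
  refine Ideal.span_le.2 ?_
  rintro _ ⟨⟨x, α, hx⟩, hxP, rfl⟩
  have hxP : x ∈ P₁ := hxP
  change x ∈ P₂
  rcases hx with hx | ⟨β, γ, f, g, hf, hg, h0, -, hx⟩
  · have : x = 0 := Subtype.ext hx
    rw [this]; exact zero_mem _
  have hg0 : algebraMap R K g ≠ 0 := by simpa using h0
  have hgD : algebraMap R D g ≠ 0 := fun h => hg0 (congrArg Subtype.val h)
  obtain ⟨p, q, r, s, hps, hfq, hfs⟩ := exists_of_isUnit_span_pair
    (hD (Ideal.span {algebraMap R D f, algebraMap R D g})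
      (fun hb => hgD (Ideal.span_eq_bot.1 hb _ (by simp)))
      (Submodule.fg_span (Set.toFinite _))
      (Ideal.homogeneous_span _ _ (by
        rintro y (rfl | rfl)
        · exact ⟨_, algebraMap_mem_gradedQuotientComponent 𝒜 hf⟩
        · exact ⟨_, algebraMap_mem_gradedQuotientComponent 𝒜 hg⟩)))
  have hx' : (x : K) * algebraMap R K g = algebraMap R K f := (eq_div_iff hg0).1 hx
  have hp : Subalgebra.inclusion hDT p = x * Subalgebra.inclusion hDT q := by
    apply Subtype.ext
    apply mul_left_cancel₀ hg0
    have : algebraMap R K f * (q : K) = algebraMap R K g * (p : K) := congrArg Subtype.val hfq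
    change algebraMap R K g * (p : K) = algebraMap R K g * ((x : K) * q)
    rw [← this, ← hx']; ring
  have hr : Subalgebra.inclusion hDT r = x * Subalgebra.inclusion hDT s := by
    apply Subtype.ext
    apply mul_left_cancel₀ hg0
    have : algebraMap R K f * (s : K) = algebraMap R K g * (r : K) := congrArg Subtype.val hfs
    change algebraMap R K g * (r : K) = algebraMap R K g * ((x : K) * s)
    rw [← this, ← hx']; ring
  have hiff : ∀ d : D, Subalgebra.inclusion hDT d ∈ P₁ ↔ Subalgebra.inclusion hDT d ∈ P₂ :=
    fun d => by rw [← Ideal.mem_comap, h, Ideal.mem_comap]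
  have hp₁ : Subalgebra.inclusion hDT p ∈ P₂ := (hiff p).1 (hp ▸ P₁.mul_mem_right _ hxP)
  have hr₂ : Subalgebra.inclusion hDT r ∈ P₂ := (hiff r).1 (hr ▸ P₁.mul_mem_right _ hxP)
  rw [hr] at hr₂
  refine (h₂.mem_or_mem hr₂).resolve_right fun hs => h₂.ne_top ((Ideal.eq_top_iff_one _).2 ?_)
  have := P₂.add_mem hp₁ hs
  rwa [← map_add, hps, map_one] at this

end Inclusion

variable {𝒜}
variable [IsAddTorsionFree Γ] [GradedRing (overringGrading 𝒜 K (integralClosure R K))]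

theorem isGradedIDomain_of_isGradedPrufer
    (hi : IsGradedIExtension R (overringGrading 𝒜 K (integralClosure R K)))
    (hp : IsGradedPrufer (overringGrading 𝒜 K (integralClosure R K))) :
    IsGradedIDomain 𝒜 K := by
  intro T _ _ Q₁ Q₂ h₁ h₂ hh₁ hh₂ hQ
  -- Adjoining homogeneous elements makes the compositum of T and the integral closure visibly
  -- graded.
  let S : Set K := homogeneousElements 𝒜 T ∪ homogeneousElements 𝒜 (integralClosure R K)
  let T' : Subalgebra R K := Algebra.adjoin R S
  obtain ⟨_⟩ : Nonempty (GradedRing (overringGrading 𝒜 K T')) :=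
    (isGradedOverring_adjoin 𝒜 (by rintro x (⟨-, hx⟩ | ⟨-, hx⟩) <;> exact hx)).2
  have hle : ∀ B : Subalgebra R K, ∀ [GradedRing (overringGrading 𝒜 K B)],
      homogeneousElements 𝒜 B ⊆ S → B ≤ T' := by
    intro B _ hB x hx
    have : AddSubgroup.closure (homogeneousElements 𝒜 B) ≤ T'.toSubring.toAddSubgroup :=
      (AddSubgroup.closure_le _).2 fun y hy => Algebra.subset_adjoin (hB hy)
    exact this (mem_closure_homogeneousElements 𝒜 B hx)
  have hT : T ≤ T' := hle T Set.subset_union_left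
  have hR : integralClosure R K ≤ T' := hle _ Set.subset_union_right
  have hint : ∀ t ∈ T', IsIntegral T t := by
    have : T' ≤ (integralClosure T K).restrictScalars R := by
      refine Algebra.adjoin_le ?_
      rintro x (⟨hx, -⟩ | ⟨hx, -⟩)
      · exact isIntegral_algebraMap (R := T) (x := ⟨x, hx⟩)
      · exact IsIntegral.tower_top (A := T) hx
    exact this
  obtain ⟨P₁, hP₁, hPh₁, rfl⟩ := exists_homogeneous_prime_over 𝒜 hT hint h₁ hh₁
  obtain ⟨P₂, hP₂, hPh₂, rfl⟩ := exists_homogeneous_prime_over 𝒜 hT hint h₂ hh₂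
  have hcomap : P₁.comap (Subalgebra.inclusion hR) = P₂.comap (Subalgebra.inclusion hR) := by
    refine hi _ _ (hP₁.comap _) (hP₂.comap _) (isHomogeneous_comap_inclusion 𝒜 hR hPh₁)
      (isHomogeneous_comap_inclusion 𝒜 hR hPh₂) ?_
    exact hQ
  rw [le_antisymm (hp.le_of_comap_le hR hP₂ hPh₁ hcomap)
    (hp.le_of_comap_le hR hP₁ hPh₂ hcomap.symm)]

/-- Otherwise the kernel of D[X] → D[x] lies in P[X], so P[X] and (P, X) descend to distinct
homogeneous primes of D[x] with the same contraction, against the gr-i property. -/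
theorem IsGradedIDomain.exists_coeff_notMem (h : IsGradedIDomain 𝒜 K)
    {P : Ideal (integralClosure R K)} (hP : P.IsPrime)
    (hPh : P.IsHomogeneous (overringGrading 𝒜 K (integralClosure R K)))
    {α : Algebra.GrothendieckAddGroup Γ} {x : K} (hx : x ∈ gradedQuotientComponent 𝒜 K α) :
    ∃ p : Polynomial (integralClosure R K), Polynomial.aeval x p = 0 ∧ ∃ i, p.coeff i ∉ P := by
  by_contra! hc
  let D := integralClosure R K
  let T : Subalgebra R K := Algebra.adjoin R (homogeneousElements 𝒜 D ∪ {x})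
  have hT : IsGradedOverring 𝒜 K T :=
    isGradedOverring_adjoin 𝒜 (by rintro y (⟨-, hy⟩ | rfl); exacts [hy, ⟨α, hx⟩])
  obtain ⟨_⟩ := hT.2
  have hDT : D ≤ T := by
    intro y hy
    have : AddSubgroup.closure (homogeneousElements 𝒜 D) ≤ T.toSubring.toAddSubgroup :=
      (AddSubgroup.closure_le _).2 fun y hy => Algebra.subset_adjoin (.inl hy)
    exact this (mem_closure_homogeneousElements 𝒜 D hy)
  let X : T := ⟨x, Algebra.subset_adjoin (.inr rfl)⟩
  let ev : Polynomial D →+* T := Polynomial.eval₂RingHom (Subalgebra.inclusion hDT).toRingHom X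
  have hevK : ∀ p, (ev p : K) = Polynomial.aeval x p := fun p =>
    Polynomial.hom_eval₂ p (Subalgebra.inclusion hDT).toRingHom T.val.toRingHom X
  have hsurj : Function.Surjective ev := by
    intro t
    have hle : T ≤ ((Polynomial.aeval (R := D) x).range).restrictScalars R := by
      refine Algebra.adjoin_le ?_
      rintro y (⟨hy, -⟩ | rfl)
      · exact ⟨Polynomial.C ⟨y, hy⟩, by simp⟩
      · exact ⟨Polynomial.X, by simp⟩
    obtain ⟨p, hp⟩ := hle t.2
    exact ⟨p, Subtype.ext ((hevK p).trans hp)⟩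
  -- P[X] and (P, X) as kernels of maps to (D/P)[X] and D/P, which makes them prime at once.
  let I₁ : Ideal (Polynomial D) := RingHom.ker (Polynomial.mapRingHom (Ideal.Quotient.mk P))
  let I₂ : Ideal (Polynomial D) := RingHom.ker ((Ideal.Quotient.mk P).comp Polynomial.constantCoeff)
  have hI₁ : I₁ = P.map Polynomial.C := by
    simp only [I₁, Polynomial.ker_mapRingHom, Ideal.mk_ker]
  have hmem₁ : ∀ p, p ∈ I₁ ↔ ∀ i, p.coeff i ∈ P := fun p => by
    rw [hI₁, Ideal.mem_map_C_iff]
  have hmem₂ : ∀ p, p ∈ I₂ ↔ p.coeff 0 ∈ P := fun p => by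
    simp only [I₂, RingHom.mem_ker, RingHom.comp_apply, Ideal.Quotient.eq_zero_iff_mem,
      Polynomial.constantCoeff_apply]
  have h12 : I₁ ≤ I₂ := fun p hp => (hmem₂ p).2 ((hmem₁ p).1 hp 0)
  have hI₂ : I₂ = I₁ ⊔ Ideal.span {Polynomial.X} := by
    refine le_antisymm (fun p hp => ?_) (sup_le h12 ?_)
    · rw [← Polynomial.divX_mul_X_add p, add_comm]
      refine Submodule.add_mem_sup ?_ (Ideal.mul_mem_left _ _ (Ideal.mem_span_singleton_self _))
      rw [hI₁]
      exact Ideal.mem_map_of_mem _ ((hmem₂ p).1 hp)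
    · rw [Ideal.span_le]
      rintro _ rfl
      exact (hmem₂ _).2 (by simp)
  have hker : RingHom.ker ev ≤ I₁ := by
    intro p hp
    refine (hmem₁ p).2 (hc p ?_)
    rw [← hevK, (RingHom.mem_ker.1 hp)]
    rfl
  have hI₁p : I₁.IsPrime := RingHom.ker_isPrime _
  have hI₂p : I₂.IsPrime := RingHom.ker_isPrime _
  have hcm : ∀ I, RingHom.ker ev ≤ I → (I.map ev).comap ev = I := by
    intro I hI
    rw [Ideal.comap_map_of_surjective ev hsurj]
    exact sup_eq_left.2 hI
  have hmc : ∀ I, RingHom.ker ev ≤ I → ∀ p, ev p ∈ I.map ev ↔ p ∈ I := fun I hI p => by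
    rw [← Ideal.mem_comap, hcm I hI]
  have hmap₁ : I₁.map ev = P.map (Subalgebra.inclusion hDT) := by
    rw [hI₁, Ideal.map_map]
    refine congrArg (fun φ => Ideal.map φ P) (RingHom.ext fun d => ?_)
    exact Polynomial.eval₂_C _ _
  have hhom₁ : (I₁.map ev).IsHomogeneous (overringGrading 𝒜 K T) := by
    rw [hmap₁]
    exact isHomogeneous_map_inclusion 𝒜 hDT hPh
  have hhom₂ : (I₂.map ev).IsHomogeneous (overringGrading 𝒜 K T) := by
    rw [hI₂, Ideal.map_sup, Ideal.map_span, Set.image_singleton]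
    refine hhom₁.sup (Ideal.homogeneous_span _ _ ?_)
    rintro _ rfl
    refine ⟨α, ?_⟩
    have : ev Polynomial.X = X := Polynomial.eval₂_X _ _
    rw [this]
    exact hx
  have heq : I₁.map ev = I₂.map ev := by
    refine h T hT _ _ (Ideal.map_isPrime_of_surjective hsurj hker)
      (Ideal.map_isPrime_of_surjective hsurj (hker.trans h12)) hhom₁ hhom₂ ?_
    ext r
    have hr : algebraMap R T r = ev (Polynomial.C (algebraMap R D r)) := by
      rw [Polynomial.coe_eval₂RingHom, Polynomial.eval₂_C]
      rfl
    rw [Ideal.mem_comap, Ideal.mem_comap, hr, hmc I₁ hker, hmc I₂ (hker.trans h12),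
      hmem₁, hmem₂]
    refine ⟨fun h => h 0, fun h i => ?_⟩
    rw [Polynomial.coeff_C_zero] at h
    rw [Polynomial.coeff_C]
    split_ifs
    · exact h
    · exact zero_mem _
  have hII : I₁ = I₂ := by rw [← hcm I₁ hker, heq, hcm I₂ (hker.trans h12)]
  -- X separates the two ideals: its constant term is 0, but its coefficient 1 is not in P.
  have hX : (Polynomial.X : Polynomial D) ∈ I₁ := by
    rw [hII, hmem₂]; simp
  have := (hmem₁ _).1 hX 1
  rw [Polynomial.coeff_X_one] at this
  exact hP.ne_top ((Ideal.eq_top_iff_one _).2 this)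

theorem IsGradedIDomain.isGradedPrufer (h : IsGradedIDomain 𝒜 K) :
    IsGradedPrufer (overringGrading 𝒜 K (integralClosure R K)) := by
  apply isGradedPrufer_of_comparable
  rintro P hP hPh f g hf0 hg0 ⟨α, hf⟩ ⟨β, hg⟩
  have hgK : (g : K) ≠ 0 := fun h => hg0 (Subtype.ext h)
  have hx : (f : K) * (g : K)⁻¹ ∈ gradedQuotientComponent 𝒜 K (α + -β) :=
    mul_mem_gradedQuotientComponent 𝒜 hf (inv_mem_gradedQuotientComponent 𝒜 hg)
  obtain ⟨p, hp0, hp⟩ := h.exists_coeff_notMem hP hPh hx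
  rcases mem_or_inv_mem_of_coeff_notMem _ _ p le_rfl hp0 hp with ⟨s, hs, d, hd⟩ | ⟨s, hs, t, ht⟩
  · refine Or.inl ⟨s, hs, d, Subtype.ext ?_⟩
    change (s : K) * ((f : K) * (g : K)⁻¹) = d at hd
    change (s : K) * f = g * d
    rw [← hd]
    field_simp
  · refine Or.inr ⟨s, hs, t, Subtype.ext ?_⟩
    change (s : K) = t * ((f : K) * (g : K)⁻¹) at ht
    change (s : K) * g = f * t
    rw [ht]
    field_simp

end Overrings

/-- The components determine the decomposition, so quantifying over the graded structure is
harmless; the first conjunct provides one. -/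
theorem mainTheorem3 {Γ R : Type*} [AddCommMonoid Γ] [IsCancelAdd Γ] [IsAddTorsionFree Γ]
    [DecidableEq Γ] [CommRing R] [IsDomain R] (𝒜 : Γ → AddSubgroup R) [GradedRing 𝒜]
    (K : Type*) [Field K] [Algebra R K] [IsFractionRing R K] :
    IsGradedOverring 𝒜 K (integralClosure R K) ∧
      ∀ [GradedRing (overringGrading 𝒜 K (integralClosure R K))],
        (IsGradedIDomain 𝒜 K ↔
          IsGradedIExtension R (overringGrading 𝒜 K (integralClosure R K)) ∧
            IsGradedPrufer (overringGrading 𝒜 K (integralClosure R K))) :=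
  ⟨isGradedOverring_integralClosure 𝒜, fun {_} =>
    ⟨fun h => ⟨h _ (isGradedOverring_integralClosure 𝒜), h.isGradedPrufer⟩,
      fun h => isGradedIDomain_of_isGradedPrufer h.1 h.2⟩⟩
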